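/- For a non-negative integer $n$, let $\mathrm{ped}(n)$ denote the number of partitions of $n$ in which the even parts are distinct (and the odd parts are unrestricted), with $\mathrm{ped}(0)=1$. For every $n\ge 0$, $$\mathrm{ped}(225n+43)\equiv 0 \pmod{24},\qquad \mathrm{ped}(225n+88)\equiv 0 \pmod{24},$$ $$\mathrm{ped}(225n+133)\equiv 0 \pmod{24},\qquad \mathrm{ped}(225n+223)\equiv 0 \pmod{24}.$$ Furthermore, for every $k\ge 1$ and $n\ge 0$, $$\mathrm{ped}(9n+7)\equiv \mathrm{ped}\left(9\cdot 5^{2k}n+\frac{57\cdot 5^{2k}-1}{8}\right)\pmod{24}.$$ -/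

import Mathlib

/-- `ped n` is the number of partitions of `n` in which the even parts are distinct, that is, no
even number occurs more than once as a part (the odd parts are unrestricted). -/
def ped (n : ℕ) : ℕ :=
  (Finset.univ.filter fun p : Nat.Partition n =>
    ∀ i ∈ p.parts, Even i → p.parts.count i = 1).card

/-! Put S = ∑ q^((s+1)^2), T = ∑ q^(s(s+1)/2), φ = 1 + 2S. Gauss's two product formulas give ∑
ped(n) (-q)^n = T/φ (`rescale_ped_mul`), and the residues mod 8 and mod 3 are read off from this
quotient.

Modulo 8, T/φ ≡ T - 2ST + 4S²T. At exponents 9n+7 the T term vanishes and S²T has even coefficients,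
so only 2ST remains; its coefficient is the number of representations of 24n+19 by v² + 2w²
(`ped_modEq_eight`). This form is anisotropic mod 5: the count vanishes when 5 divides m exactly
once and is unchanged under m ↦ 25m.

Modulo 3, `ped` vanishes along 9n+7 (`three_dvd_ped`). With F = φ and G = 2T, the relation qG⁸ = F⁴
- F⁸ turns the part of -G/F with exponents 1 mod 3 into q(G³F)³, and G³F has no exponents 2 mod 3.
The relation comes from 3 dividing the number of representations of 4m as four squares (m > 0), by
the free action of a Hurwitz unit of order 3. -/

open PowerSeries Finset

/-! ### Finite forms of Gauss's product identities -/

section Shanks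

variable {R : Type*} [CommRing R] (x : R)

/-- Raising n by one in `shanks_square` changes the correction terms by a telescoping sum; at m = n
what is left is the new square term x^((n+1)^2). -/
lemma shanks_square_telescope (n m : ℕ) (hm : m ≤ n) :
    (1 - x ^ (n + 1)) * ∏ i ∈ range n, (1 - x ^ (i + 1)) -
      (1 + x ^ (n + 1)) * ∏ i ∈ range n, (1 - x ^ (i + 1)) +
      2 * ∑ s ∈ range m, (-1) ^ (s + 1) *
        (x ^ ((s + 1) * (n + 2)) * (1 - x ^ (n + 1)) - (1 + x ^ (n + 1)) * x ^ ((s + 1) * (n + 1))) *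
        (∏ i ∈ Ico (s + 1) n, (1 - x ^ (i + 1))) * ∏ i ∈ range s, (1 + x ^ (i + 1)) =
    2 * (-1) ^ (m + 1) * x ^ ((m + 1) * (n + 1)) * (∏ i ∈ Ico m n, (1 - x ^ (i + 1))) *
      ∏ i ∈ range m, (1 + x ^ (i + 1)) := by
  induction m with
  | zero => simp only [range_zero, sum_empty, prod_empty, Nat.Ico_zero_eq_range]; ring
  | succ m ih =>
    rw [sum_range_succ, mul_add, ← add_assoc, ih (by omega), prod_range_succ,
      prod_eq_prod_Ico_succ_bot (show m < n by omega)]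
    ring

/-- Finite form of Gauss's product for the series of squares. -/
theorem shanks_square (n : ℕ) :
    (∏ i ∈ range n, (1 + x ^ (i + 1))) *
      (1 + 2 * ∑ s ∈ range n, (-1) ^ (s + 1) * x ^ ((s + 1) ^ 2)) =
    ∏ i ∈ range n, (1 - x ^ (i + 1)) +
      2 * ∑ s ∈ range n, (-1) ^ (s + 1) * x ^ ((s + 1) * (n + 1)) *
        (∏ i ∈ Ico (s + 1) n, (1 - x ^ (i + 1))) * ∏ i ∈ range s, (1 + x ^ (i + 1)) := by
  induction n with
  | zero => simp
  | succ n ih =>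
    have key := shanks_square_telescope x n n le_rfl
    rw [sum_congr rfl (g := fun s => (-1) ^ (s + 1) * x ^ ((s + 1) * (n + 1 + 1)) *
        (∏ i ∈ Ico (s + 1) (n + 1), (1 - x ^ (i + 1))) * ∏ i ∈ range s, (1 + x ^ (i + 1)) -
        (1 + x ^ (n + 1)) * ((-1) ^ (s + 1) * x ^ ((s + 1) * (n + 1)) *
        (∏ i ∈ Ico (s + 1) n, (1 - x ^ (i + 1))) * ∏ i ∈ range s, (1 + x ^ (i + 1))))
        (fun s hs => by
          rw [prod_Ico_succ_top (by have := mem_range.1 hs; omega)]; ring),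
      sum_sub_distrib, ← mul_sum] at key
    rw [sum_range_succ _ n, prod_range_succ, prod_range_succ _ n, sum_range_succ _ n]
    simp only [Ico_self, prod_empty] at key ⊢
    linear_combination (1 + x ^ (n + 1)) * ih - key

lemma shanks_triangle_telescope (n m : ℕ) (hm : m ≤ n) :
    ∑ s ∈ range (m + 1), (x ^ (s * (2 * n + 3)) * (1 - x ^ (2 * n + 2)) -
        (1 - x ^ (2 * n + 1)) * x ^ (s * (2 * n + 1))) *
        (∏ i ∈ Ico s n, (1 - x ^ (2 * i + 2))) * ∏ i ∈ range s, (1 - x ^ (2 * i + 1)) =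
    x ^ ((m + 1) * (2 * n + 1)) * (∏ i ∈ Ico m n, (1 - x ^ (2 * i + 2))) *
      ∏ i ∈ range (m + 1), (1 - x ^ (2 * i + 1)) := by
  induction m with
  | zero => simp; ring
  | succ m ih =>
    rw [sum_range_succ, ih (by omega), prod_range_succ _ (m + 1),
      prod_eq_prod_Ico_succ_bot (show m < n by omega)]
    ring

/-- Finite form of Gauss's product for the series of triangular numbers. -/
theorem shanks_triangle (n : ℕ) :
    (∏ i ∈ range n, (1 - x ^ (2 * i + 1))) * ∑ s ∈ range (2 * n + 1), x ^ (s * (s + 1) / 2) =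
    ∑ s ∈ range (n + 1), x ^ (s * (2 * n + 1)) * (∏ i ∈ Ico s n, (1 - x ^ (2 * i + 2))) *
      ∏ i ∈ range s, (1 - x ^ (2 * i + 1)) := by
  induction n with
  | zero => simp
  | succ n ih =>
    have key := shanks_triangle_telescope x n n le_rfl
    rw [sum_congr rfl (g := fun s => x ^ (s * (2 * (n + 1) + 1)) *
        (∏ i ∈ Ico s (n + 1), (1 - x ^ (2 * i + 2))) * ∏ i ∈ range s, (1 - x ^ (2 * i + 1)) -
        (1 - x ^ (2 * n + 1)) * (x ^ (s * (2 * n + 1)) *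
        (∏ i ∈ Ico s n, (1 - x ^ (2 * i + 2))) * ∏ i ∈ range s, (1 - x ^ (2 * i + 1))))
        (fun s hs => by
          rw [prod_Ico_succ_top (by have := mem_range.1 hs; omega)]; ring),
      sum_sub_distrib, ← mul_sum] at key
    have h1 : (2 * n + 1) * (2 * n + 1 + 1) / 2 = (n + 1) * (2 * n + 1) := by
      apply Nat.div_eq_of_eq_mul_left two_pos; ring
    have h2 : (2 * n + 1 + 1) * (2 * n + 1 + 1 + 1) / 2 = (n + 1) * (2 * (n + 1) + 1) := by
      apply Nat.div_eq_of_eq_mul_left two_pos; ring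
    rw [show 2 * (n + 1) + 1 = 2 * n + 1 + 1 + 1 by ring, sum_range_succ, sum_range_succ, h1, h2,
      prod_range_succ, sum_range_succ _ (n + 1)]
    rw [prod_range_succ] at key
    simp only [Ico_self, prod_empty, prod_range_succ _ n] at key ⊢
    linear_combination (1 - x ^ (2 * n + 1)) * ih - key

end Shanks

/-! ### The generating function of `ped` as a limit of products -/

open scoped PowerSeries.WithPiTopology in
/-- The partial products of the generating function of `ped` converge to it coefficientwise. -/
theorem tendsto_ped_partial_prod [TopologicalSpace ℤ] [DiscreteTopology ℤ] :
    ∃ Q : ℕ → ℤ⟦X⟧,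
      (∀ n, Q n * ∏ i ∈ range n, (1 - X ^ (2 * i + 1)) = ∏ i ∈ range n, (1 + X ^ (2 * i + 2))) ∧
      Filter.Tendsto Q Filter.atTop (nhds (PowerSeries.mk fun n => (ped n : ℤ))) := by
  let w : ℕ → ℕ → ℤ := fun i c => if Even i → c = 1 then 1 else 0
  have hgen : Nat.Partition.genFun w = PowerSeries.mk fun n => (ped n : ℤ) := by
    ext n
    simp only [Nat.Partition.coeff_genFun, coeff_mk, ped, card_filter, Nat.cast_sum, w,
      Finsupp.prod, prod_boole]
    refine sum_congr rfl fun p _ => ?_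
    simp
  have hprod := Nat.Partition.hasProd_genFun w
  rw [hgen] at hprod
  -- `F i` is the factor of the part i + 1: even indices belong to odd parts (geometric series), odd
  -- indices to even parts (only multiplicity 1 survives).
  let F : ℕ → ℤ⟦X⟧ := fun i => 1 + ∑' j, w (i + 1) (j + 1) • X ^ ((i + 1) * (j + 1))
  have hodd : ∀ i, F (2 * i) * (1 - X ^ (2 * i + 1)) = 1 := by
    intro i
    have : F (2 * i) = ∑' j : ℕ, (X ^ (2 * i + 1)) ^ j := by
      rw [tsum_eq_zero_add' ?_]
      · simp [F, w, pow_mul]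
      simp_rw [pow_succ]
      apply Summable.mul_right
      exact WithPiTopology.summable_pow_of_constantCoeff_eq_zero (by simp)
    rw [this, WithPiTopology.tsum_pow_mul_one_sub_of_constantCoeff_eq_zero (by simp)]
  have heven : ∀ i, F (2 * i + 1) = 1 + X ^ (2 * i + 2) := by
    intro i
    simp only [F]
    rw [tsum_eq_single 0]
    · simp [w]
    · intro j hj
      have : Even (2 * i + 1 + 1) := ⟨i + 1, by ring⟩
      simp [w, this, hj]
  refine ⟨fun n => ∏ i ∈ range (2 * n), F i, fun n => ?_, ?_⟩
  · dsimp only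
    induction n with
    | zero => simp
    | succ n ih =>
      rw [show 2 * (n + 1) = 2 * n + 1 + 1 by ring, prod_range_succ _ (2 * n + 1),
        prod_range_succ _ (2 * n), prod_range_succ _ n, prod_range_succ _ n, ← ih, heven]
      linear_combination (∏ i ∈ range (2 * n), F i) * (∏ i ∈ range n, (1 - X ^ (2 * i + 1))) *
        (1 + X ^ (2 * n + 2)) * hodd n
  · exact hprod.tendsto_prod_nat.comp (Filter.tendsto_id.const_mul_atTop' two_pos)

/-! ### Series counting representations -/

section RepSeries

variable {ι κ : Type*} (R : Type*) [CommRing R]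

/-- The generating function of the number of representations `i ↦ f i = n`. -/
noncomputable def repSeries (f : ι → ℕ) : R⟦X⟧ :=
  PowerSeries.mk fun n => (Nat.card {i // f i = n} : R)

/-- Every value of `f` is attained finitely often. -/
def FiniteFibers (f : ι → ℕ) : Prop := ∀ n, Finite {i // f i = n}

variable {R}

@[simp]
lemma coeff_repSeries (f : ι → ℕ) (n : ℕ) :
    coeff n (repSeries R f) = (Nat.card {i // f i = n} : R) := coeff_mk _ _

lemma map_repSeries {S : Type*} [CommRing S] (φ : R →+* S) (f : ι → ℕ) :
    PowerSeries.map φ (repSeries R f) = repSeries S f := by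
  ext n; simp

lemma repSeries_equiv (e : ι ≃ κ) {f : ι → ℕ} {g : κ → ℕ} (h : ∀ i, g (e i) = f i) :
    repSeries R f = repSeries R g := by
  ext n
  rw [coeff_repSeries, coeff_repSeries]
  exact congrArg _ (Nat.card_congr (e.subtypeEquiv fun i => by rw [h]))

lemma FiniteFibers.equiv (e : ι ≃ κ) {f : ι → ℕ} {g : κ → ℕ} (h : ∀ i, g (e i) = f i)
    (hg : FiniteFibers g) : FiniteFibers f := fun n =>
  have := hg n
  Finite.of_equiv _ (e.subtypeEquiv (p := fun i => f i = n) (q := fun i => g i = n)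
    fun i => by rw [h]).symm

/-- Finite fibers matter because `Nat.card` of an infinite type is 0, which would break additivity.
-/
lemma repSeries_sum {f : ι → ℕ} {g : κ → ℕ} (hf : FiniteFibers f) (hg : FiniteFibers g) :
    repSeries R (Sum.elim f g) = repSeries R f + repSeries R g := by
  ext n
  have := hf n
  have := hg n
  rw [map_add, coeff_repSeries, coeff_repSeries, coeff_repSeries, ← Nat.cast_add,
    ← Nat.card_sum]
  exact congrArg _ (Nat.card_congr (Equiv.subtypeSum (p := fun i => Sum.elim f g i = n)))

/-- The fiber of `f + g` over `n`, sorted by the value of `f`. -/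
def fiberAddEquiv (f : ι → ℕ) (g : κ → ℕ) (n : ℕ) :
    {p : ι × κ // f p.1 + g p.2 = n} ≃
      Σ a : antidiagonal n, {i // f i = a.1.1} × {j // g j = a.1.2} where
  toFun p := ⟨⟨(f p.1.1, g p.1.2), by simpa using p.2⟩, ⟨p.1.1, rfl⟩, ⟨p.1.2, rfl⟩⟩
  invFun q := ⟨(q.2.1.1, q.2.2.1), by
    rw [q.2.1.2, q.2.2.2]; exact mem_antidiagonal.1 q.1.2⟩
  left_inv p := rfl
  right_inv := by
    rintro ⟨⟨⟨a, b⟩, h⟩, ⟨i, hi⟩, ⟨j, hj⟩⟩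
    dsimp only at hi hj
    subst hi hj
    rfl

lemma FiniteFibers.add {f : ι → ℕ} {g : κ → ℕ} (hf : FiniteFibers f) (hg : FiniteFibers g) :
    FiniteFibers fun p : ι × κ => f p.1 + g p.2 := fun n =>
  have := hf
  have := hg
  have : ∀ a : antidiagonal n, Finite ({i // f i = a.1.1} × {j // g j = a.1.2}) := fun a =>
    have := hf a.1.1
    have := hg a.1.2
    inferInstance
  Finite.of_equiv _ (fiberAddEquiv f g n).symm

lemma repSeries_mul {f : ι → ℕ} {g : κ → ℕ} (hf : FiniteFibers f) (hg : FiniteFibers g) :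
    repSeries R f * repSeries R g = repSeries R fun p : ι × κ => f p.1 + g p.2 := by
  ext n
  have : ∀ a : antidiagonal n, Finite ({i // f i = a.1.1} × {j // g j = a.1.2}) := fun a =>
    have := hf a.1.1
    have := hg a.1.2
    inferInstance
  rw [coeff_mul, coeff_repSeries, Nat.card_congr (fiberAddEquiv f g n), Nat.card_sigma,
    ← Finset.sum_coe_sort]
  simp [Nat.card_prod]

lemma finiteFibers_of_injective {f : ι → ℕ} (hf : Function.Injective f) : FiniteFibers f :=
  fun n =>
    have : Subsingleton {i // f i = n} := ⟨fun a b => Subtype.ext (hf (a.2.trans b.2.symm))⟩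
    inferInstance

lemma FiniteFibers.mul_left {f : ι → ℕ} (hf : FiniteFibers f) {k : ℕ} (hk : k ≠ 0) :
    FiniteFibers fun i => k * f i := fun n =>
  have := hf (n / k)
  Finite.of_injective (β := {i // f i = n / k})
    (fun i => ⟨i.1, (Nat.div_eq_of_eq_mul_right (Nat.pos_of_ne_zero hk) i.2.symm).symm⟩)
    fun _ _ h => Subtype.ext (Subtype.mk.inj h)

lemma expand_repSeries (f : ι → ℕ) {k : ℕ} (hk : k ≠ 0) :
    expand k hk (repSeries R f) = repSeries R fun i => k * f i := by
  ext n
  by_cases h : k ∣ n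
  · obtain ⟨m, rfl⟩ := h
    rw [coeff_expand_mul, coeff_repSeries, coeff_repSeries]
    simp only [mul_right_inj' hk]
  · rw [coeff_expand_of_not_dvd _ hk _ h, coeff_repSeries]
    have : IsEmpty {i // k * f i = n} := ⟨fun i => h ⟨_, i.2.symm⟩⟩
    simp

lemma coeff_repSeries_eq_zero {f : ι → ℕ} {n : ℕ} (h : ∀ i, f i ≠ n) :
    coeff n (repSeries R f) = 0 := by
  have : IsEmpty {i // f i = n} := ⟨fun i => h _ i.2⟩
  simp

/-- A representation series indexed by `ℕ` is the limit of its partial sums. -/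
lemma coeff_repSeries_eq_sum {f : ℕ → ℕ} (hf : ∀ s, s ≤ f s) {d n : ℕ} (h : d < n) :
    coeff d (repSeries R f) = coeff d (∑ s ∈ range n, (X : R⟦X⟧) ^ f s) := by
  rw [coeff_repSeries, map_sum]
  simp only [coeff_X_pow]
  rw [sum_boole, ← Nat.card_eq_finsetCard]
  refine congrArg _ (Nat.card_congr (Equiv.subtypeEquivRight fun s => ?_))
  rw [mem_filter, mem_range]
  have := hf s
  constructor
  · rintro rfl
    exact ⟨by omega, rfl⟩
  · exact fun h => h.2.symm

end RepSeries

/-! ### Gauss's identities in the limit and the quotient formula for `ped` -/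

open scoped PowerSeries.WithPiTopology in
lemma tendsto_sum_repSeries [TopologicalSpace ℤ] {f : ℕ → ℕ} (hf : ∀ s, s ≤ f s) :
    Filter.Tendsto (fun n => ∑ s ∈ range n, (X : ℤ⟦X⟧) ^ f s) Filter.atTop
      (nhds (repSeries ℤ f)) := by
  rw [WithPiTopology.tendsto_iff_coeff_tendsto]
  intro d
  refine tendsto_atTop_of_eventually_const (i₀ := d + 1) fun n hn => ?_
  rw [coeff_repSeries_eq_sum hf (show d < n by omega)]

lemma rescale_X_pow (k : ℕ) : rescale (-1 : ℤ) (X ^ k) = (-X : ℤ⟦X⟧) ^ k := by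
  rw [map_pow, rescale_neg_one_X]

lemma X_pow_dvd_gauss_square (n : ℕ) :
    ∃ E : ℤ⟦X⟧, (∏ i ∈ range (2 * n), (1 + X ^ (i + 1))) *
      rescale (-1) (1 + 2 * ∑ s ∈ range (2 * n), X ^ ((s + 1) ^ 2)) =
      ∏ i ∈ range (2 * n), (1 - X ^ (i + 1)) + X ^ (2 * n + 1) * E := by
  have h := shanks_square (X : ℤ⟦X⟧) (2 * n)
  have h2 : rescale (-1 : ℤ) (1 + 2 * ∑ s ∈ range (2 * n), X ^ ((s + 1) ^ 2)) =
      1 + 2 * ∑ s ∈ range (2 * n), (-1) ^ (s + 1) * (X : ℤ⟦X⟧) ^ ((s + 1) ^ 2) := by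
    rw [map_add, map_mul, map_sum, map_one, map_ofNat]
    refine congrArg (fun t : ℤ⟦X⟧ => 1 + 2 * t) (sum_congr rfl fun s _ => ?_)
    rw [rescale_X_pow, neg_pow]
    congr 1
    rcases Nat.even_or_odd (s + 1) with hs | hs
    · rw [hs.neg_one_pow, (hs.pow_of_ne_zero two_ne_zero).neg_one_pow]
    · rw [hs.neg_one_pow, hs.pow.neg_one_pow]
  rw [h2, h]
  refine ⟨2 * ∑ s ∈ range (2 * n), (-1) ^ (s + 1) * X ^ (s * (2 * n + 1)) *
    (∏ i ∈ Ico (s + 1) (2 * n), (1 - X ^ (i + 1))) * ∏ i ∈ range s, (1 + X ^ (i + 1)), ?_⟩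
  rw [add_right_inj, mul_left_comm (X ^ (2 * n + 1)), mul_sum _ _ (X ^ (2 * n + 1))]
  refine congrArg (fun t : ℤ⟦X⟧ => 2 * t) (sum_congr rfl fun s _ => ?_)
  ring

lemma X_pow_dvd_gauss_triangle (n : ℕ) :
    ∃ E : ℤ⟦X⟧, (∏ i ∈ range n, (1 + X ^ (2 * i + 1))) *
      rescale (-1) (∑ s ∈ range (2 * n + 1), X ^ (s * (s + 1) / 2)) =
      ∏ i ∈ range n, (1 - X ^ (2 * i + 2)) + X ^ (2 * n + 1) * E := by
  have h := shanks_triangle (-X : ℤ⟦X⟧) n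
  have ho : ∀ i, (1 : ℤ⟦X⟧) - (-X) ^ (2 * i + 1) = 1 + X ^ (2 * i + 1) := fun i => by
    rw [Odd.neg_pow ⟨i, rfl⟩, sub_neg_eq_add]
  have he : ∀ i, (1 : ℤ⟦X⟧) - (-X) ^ (2 * i + 2) = 1 - X ^ (2 * i + 2) := fun i => by
    rw [Even.neg_pow ⟨i + 1, by ring⟩]
  simp only [ho, he] at h
  rw [map_sum]
  simp only [rescale_X_pow]
  -- The s = 0 term is the main product; every other term carries a factor X^(2n+1).
  rw [h, sum_range_succ', add_comm]
  refine ⟨∑ s ∈ range n, -(-X) ^ (s * (2 * n + 1)) *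
    (∏ i ∈ Ico (s + 1) n, (1 - X ^ (2 * i + 2))) * ∏ i ∈ range (s + 1), (1 + X ^ (2 * i + 1)), ?_⟩
  rw [mul_sum]
  congr 1
  · simp [Nat.Ico_zero_eq_range]
  · refine sum_congr rfl fun s _ => ?_
    rw [show (s + 1) * (2 * n + 1) = (2 * n + 1) + s * (2 * n + 1) by ring, pow_add,
      Odd.neg_pow ⟨n, rfl⟩]
    ring

lemma prod_range_two_mul {M : Type*} [CommMonoid M] (f : ℕ → M) (n : ℕ) :
    ∏ i ∈ range (2 * n), f (i + 1) =
      (∏ i ∈ range n, f (2 * i + 1)) * ∏ i ∈ range n, f (2 * i + 2) := by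
  induction n with
  | zero => simp
  | succ n ih =>
    rw [show 2 * (n + 1) = 2 * n + 1 + 1 by ring, prod_range_succ, prod_range_succ, ih,
      prod_range_succ _ n, prod_range_succ _ n, show 2 * n + 1 + 1 = 2 * n + 2 by ring]
    ac_rfl

open scoped PowerSeries.WithPiTopology in
lemma ped_mul_rescale :
    (PowerSeries.mk fun n => (ped n : ℤ)) *
      rescale (-1) (1 + 2 * repSeries ℤ fun s : ℕ => (s + 1) ^ 2) =
      rescale (-1) (repSeries ℤ fun s : ℕ => s * (s + 1) / 2) := by
  let _ : TopologicalSpace ℤ := ⊥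
  have _ : DiscreteTopology ℤ := ⟨rfl⟩
  obtain ⟨Q, hQ, hlim⟩ := tendsto_ped_partial_prod
  have hrescale : Continuous (rescale (-1 : ℤ)) := by
    refine continuous_iff_continuousAt.2 fun f => ?_
    rw [ContinuousAt, WithPiTopology.tendsto_iff_coeff_tendsto]
    intro d
    simp only [coeff_rescale]
    exact ((WithPiTopology.continuous_coeff ℤ d).tendsto f).const_mul _
  have hS : Filter.Tendsto (fun n => rescale (-1 : ℤ)
      (1 + 2 * ∑ s ∈ range (2 * n), (X : ℤ⟦X⟧) ^ ((s + 1) ^ 2))) Filter.atTop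
      (nhds (rescale (-1) (1 + 2 * repSeries ℤ fun s : ℕ => (s + 1) ^ 2))) :=
    (hrescale.tendsto _).comp ((((tendsto_sum_repSeries fun s => by nlinarith).comp
      (Filter.tendsto_id.const_mul_atTop' two_pos)).const_mul 2).const_add 1)
  have hT : Filter.Tendsto (fun n => rescale (-1 : ℤ)
      (∑ s ∈ range (2 * n + 1), (X : ℤ⟦X⟧) ^ (s * (s + 1) / 2))) Filter.atTop
      (nhds (rescale (-1) (repSeries ℤ fun s : ℕ => s * (s + 1) / 2))) :=
    (hrescale.tendsto _).comp ((tendsto_sum_repSeries fun s => by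
      rw [Nat.le_div_iff_mul_le two_pos]; nlinarith [Nat.le_mul_self s]).comp
      ((Filter.tendsto_add_atTop_nat 1).comp (Filter.tendsto_id.const_mul_atTop' two_pos)))
  have h0 := (hlim.mul hS).sub hT
  refine sub_eq_zero.1 (tendsto_nhds_unique h0 ?_)
  rw [WithPiTopology.tendsto_iff_coeff_tendsto]
  intro d
  refine tendsto_atTop_of_eventually_const (i₀ := d) fun n hn => ?_
  rw [map_zero]
  refine (X_pow_dvd_iff (n := 2 * n + 1)).1 ?_ d (by omega)
  obtain ⟨E, hE⟩ := X_pow_dvd_gauss_square n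
  obtain ⟨E', hE'⟩ := X_pow_dvd_gauss_triangle n
  rw [prod_range_two_mul fun i => (1 + X ^ i : ℤ⟦X⟧),
    prod_range_two_mul fun i => (1 - X ^ i : ℤ⟦X⟧)] at hE
  -- Multiplying by this unit clears the products in both finite identities without affecting
  -- divisibility by X^(2n+1).
  have hu : IsUnit ((∏ i ∈ range n, (1 + X ^ (2 * i + 1))) *
      ∏ i ∈ range n, (1 + X ^ (2 * i + 2)) : ℤ⟦X⟧) := by
    rw [PowerSeries.isUnit_iff_constantCoeff]
    simp [map_prod]
  rw [← hu.dvd_mul_left]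
  refine ⟨Q n * E - (∏ i ∈ range n, (1 + X ^ (2 * i + 2))) * E', ?_⟩
  linear_combination Q n * hE + (∏ i ∈ range n, (1 - X ^ (2 * i + 2))) * hQ n -
    (∏ i ∈ range n, (1 + X ^ (2 * i + 2))) * hE'

/-- With alternating signs, the generating function of `ped` is the quotient of the series of
triangular numbers by the theta series of squares. -/
theorem rescale_ped_mul :
    rescale (-1) (PowerSeries.mk fun n => (ped n : ℤ)) *
      (1 + 2 * repSeries ℤ fun s : ℕ => (s + 1) ^ 2) = repSeries ℤ fun s : ℕ => s * (s + 1) / 2 := by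
  have h := congrArg (rescale (-1 : ℤ)) ped_mul_rescale
  have hr : ∀ f : ℤ⟦X⟧, rescale (-1 : ℤ) (rescale (-1) f) = f := fun f => by
    rw [rescale_rescale]; simp
  rwa [map_mul, hr, hr] at h

/-! ### Theta series over the integers -/

/-- The triangular number `u (u + 1) / 2` of an integer `u`. -/
def triInt (u : ℤ) : ℕ := (u * (u + 1) / 2).toNat

lemma eight_mul_triInt (u : ℤ) : 8 * (triInt u : ℤ) + 1 = (2 * u + 1) ^ 2 := by
  have h0 : 0 ≤ u * (u + 1) := by
    rcases le_or_gt 0 u with h | h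
    · positivity
    · nlinarith
  have h2 := Int.ediv_mul_cancel (Int.even_mul_succ_self u).two_dvd
  rw [triInt, Int.toNat_of_nonneg (by omega)]
  linear_combination 4 * h2

lemma eight_mul_triNat (s : ℕ) : 8 * (s * (s + 1) / 2) + 1 = (2 * s + 1) ^ 2 := by
  have h2 := Nat.div_mul_cancel (Nat.even_mul_succ_self s).two_dvd
  linarith [show (2 * s + 1) ^ 2 = 4 * (s * (s + 1)) + 1 by ring]

section Theta

variable (R : Type*) [CommRing R]

/-- The theta series `∑ X ^ (x ^ 2)` over all integers `x`. -/
noncomputable def theta : R⟦X⟧ := repSeries R fun x : ℤ => x.natAbs ^ 2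

/-- The theta series `∑ X ^ (u * (u + 1) / 2)` over all integers `u`. -/
noncomputable def thetaTri : R⟦X⟧ := repSeries R triInt

variable {R}

lemma FiniteFibers.sum {ι κ : Type*} {f : ι → ℕ} {g : κ → ℕ} (hf : FiniteFibers f)
    (hg : FiniteFibers g) : FiniteFibers (Sum.elim f g) := fun n =>
  have : Finite {i // Sum.elim f g (Sum.inl i) = n} := hf n
  have : Finite {i // Sum.elim f g (Sum.inr i) = n} := hg n
  Finite.of_equiv _ (Equiv.subtypeSum (p := fun i => Sum.elim f g i = n)).symm

lemma finiteFibers_sq_nat : FiniteFibers fun s : ℕ => s ^ 2 :=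
  finiteFibers_of_injective (Nat.pow_left_injective two_ne_zero)

lemma finiteFibers_succ_sq : FiniteFibers fun s : ℕ => (s + 1) ^ 2 :=
  finiteFibers_of_injective ((Nat.pow_left_injective two_ne_zero).comp (add_left_injective 1))

lemma finiteFibers_triNat : FiniteFibers fun s : ℕ => s * (s + 1) / 2 :=
  finiteFibers_of_injective fun a b h => by
    have ha := eight_mul_triNat a
    have hb := eight_mul_triNat b
    rw [h, hb] at ha
    have : 2 * b + 1 = 2 * a + 1 := Nat.pow_left_injective two_ne_zero ha
    omega

lemma natAbs_sq_intEquiv (x : ℤ) :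
    Sum.elim (fun s : ℕ => s ^ 2) (fun s : ℕ => (s + 1) ^ 2) (Equiv.intEquivNatSumNat x) =
      x.natAbs ^ 2 := by
  cases x <;> rfl

lemma triInt_intEquiv (u : ℤ) :
    Sum.elim (fun s : ℕ => s * (s + 1) / 2) (fun s : ℕ => s * (s + 1) / 2)
      (Equiv.intEquivNatSumNat u) = triInt u := by
  have h := eight_mul_triInt u
  zify
  cases u with
  | ofNat s =>
    have := eight_mul_triNat s
    zify at this
    change ((s * (s + 1) / 2 : ℕ) : ℤ) = _
    rw [Int.ofNat_eq_natCast] at h ⊢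
    push_cast
    linarith
  | negSucc s =>
    have := eight_mul_triNat s
    zify at this
    change ((s * (s + 1) / 2 : ℕ) : ℤ) = _
    rw [Int.negSucc_eq] at h ⊢
    push_cast
    linarith [show (2 * -((s : ℤ) + 1) + 1) ^ 2 = (2 * s + 1) ^ 2 by ring]

lemma finiteFibers_sq : FiniteFibers fun x : ℤ => x.natAbs ^ 2 :=
  (finiteFibers_sq_nat.sum finiteFibers_succ_sq).equiv _ natAbs_sq_intEquiv

lemma finiteFibers_triInt : FiniteFibers triInt :=
  (finiteFibers_triNat.sum finiteFibers_triNat).equiv _ triInt_intEquiv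

lemma theta_eq : theta R = 1 + 2 * repSeries R fun s : ℕ => (s + 1) ^ 2 := by
  have h0 : repSeries R (fun s : ℕ => s ^ 2) = (repSeries R fun s : ℕ => (s + 1) ^ 2) + 1 := by
    have h1 : (repSeries R fun _ : PUnit.{1} => 0) = 1 := by
      ext n
      rw [coeff_repSeries, coeff_one]
      split_ifs with h
      · simp [h]
      · have : IsEmpty {i : PUnit.{1} // 0 = n} := ⟨fun i => h i.2.symm⟩
        rw [Nat.card_of_isEmpty, Nat.cast_zero]
    rw [← h1, ← repSeries_sum finiteFibers_succ_sq
      (fun n => inferInstance : FiniteFibers fun _ : PUnit.{1} => 0)]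
    refine (repSeries_equiv Equiv.natSumPUnitEquivNat ?_).symm
    rintro (s | s) <;> rfl
  rw [theta, repSeries_equiv Equiv.intEquivNatSumNat natAbs_sq_intEquiv,
    repSeries_sum finiteFibers_sq_nat finiteFibers_succ_sq, h0]
  ring

/-- The involution u ↦ -1 - u preserves triangular numbers and swaps nonnegative and negative u. -/
lemma thetaTri_eq : thetaTri R = 2 * repSeries R fun s : ℕ => s * (s + 1) / 2 := by
  rw [thetaTri, repSeries_equiv Equiv.intEquivNatSumNat triInt_intEquiv,
    repSeries_sum finiteFibers_triNat finiteFibers_triNat]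
  ring

end Theta

/-! ### `ped` modulo 8 and the form v² + 2w² -/

/-- The number of representations of `m` by the form `v ^ 2 + 2 w ^ 2`. -/
noncomputable def repCount (m : ℕ) : ℕ :=
  Nat.card {p : ℤ × ℤ // p.1.natAbs ^ 2 + 2 * p.2.natAbs ^ 2 = m}

lemma natAbs_form_iff (v w : ℤ) (m : ℕ) :
    v.natAbs ^ 2 + 2 * w.natAbs ^ 2 = m ↔ v ^ 2 + 2 * w ^ 2 = m := by
  zify; simp

lemma coeff_two_mul (f : ℤ⟦X⟧) (n : ℕ) : coeff n (2 * f) = 2 * coeff n f := by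
  rw [two_mul, map_add, two_mul]

/-- The number 24n+19 is odd and 3 mod 8, hence neither a square nor twice a square; both
coordinates are nonzero and their signs are free. -/
lemma four_dvd_repCount (n : ℕ) : 4 ∣ repCount (24 * n + 19) := by
  have h : theta ℤ * expand 2 two_ne_zero (theta ℤ) =
      repSeries ℤ fun p : ℤ × ℤ => p.1.natAbs ^ 2 + 2 * p.2.natAbs ^ 2 := by
    rw [theta, expand_repSeries,
      repSeries_mul finiteFibers_sq (finiteFibers_sq.mul_left two_ne_zero)]
  rw [theta_eq, map_add, map_mul, map_one, map_ofNat, expand_repSeries] at h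
  have hc := congrArg (coeff (24 * n + 19)) h
  rw [coeff_repSeries] at hc
  have hS : coeff (24 * n + 19) (repSeries ℤ fun s : ℕ => (s + 1) ^ 2) = 0 :=
    coeff_repSeries_eq_zero fun s hs => by
      have : ∀ a : ZMod 8, a ^ 2 ≠ 3 := by decide
      refine this ((s + 1 : ℕ) : ZMod 8) ?_
      rw [← Nat.cast_pow, hs, show 24 * n + 19 = 8 * (3 * n + 2) + 3 by ring]
      simp [show (8 : ZMod 8) = 0 from rfl]
  have hS2 : coeff (24 * n + 19) (repSeries ℤ fun s : ℕ => 2 * (s + 1) ^ 2) = 0 :=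
    coeff_repSeries_eq_zero fun s hs => by omega
  rw [show ∀ a b : ℤ⟦X⟧, (1 + 2 * a) * (1 + 2 * b) = 1 + 2 * a + 2 * b + 2 * (2 * (a * b)) by
    intros; ring, map_add, map_add, map_add, coeff_two_mul, coeff_two_mul, coeff_two_mul,
    coeff_two_mul, hS, hS2, coeff_one, if_neg (by omega)] at hc
  rw [← Int.natCast_dvd_natCast]
  exact ⟨_, by rw [repCount, ← hc]; push_cast; ring⟩

/-- Completing the square gives (2c+1)² + 2(2x)² = 3(24n+19). Since (v-2w)² + 2(v+w)² = 3(v²+2w²),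
multiplication by an element of norm 3 in ℤ[√-2] supplies the solutions; the sign of x selects one
of the two conjugate elements. -/
lemma card_triangular_form (n : ℕ) :
    Nat.card {p : ℤ × ℤ // p.1.natAbs ^ 2 + triInt p.2 = 9 * n + 7} =
      2 * repCount (24 * n + 19) := by
  have hiff : ∀ x c : ℤ, x.natAbs ^ 2 + triInt c = 9 * n + 7 ↔
      8 * x ^ 2 + (2 * c + 1) ^ 2 = 3 * (24 * n + 19) := by
    intro x c
    have := eight_mul_triInt c
    zify
    rw [sq_abs]
    constructor <;> intro h <;> linarith
  have hodd : ∀ v w : ℤ, v ^ 2 + 2 * w ^ 2 = (24 * n + 19 : ℕ) →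
      v % 2 = 1 ∧ w % 2 = 1 := by
    intro v w h
    -- In `ZMod 8`, 4a = 4 says that a is odd.
    have key : ∀ a b : ZMod 8, a ^ 2 + 2 * b ^ 2 = 3 → 4 * a = 4 ∧ 4 * b = 4 := by decide
    have h' := congrArg (Int.cast : ℤ → ZMod 8) h
    rw [show 24 * n + 19 = 8 * (3 * n + 2) + 3 by ring] at h'
    push_cast at h'
    rw [show (8 : ZMod 8) = 0 from rfl, zero_mul, zero_add] at h'
    have h1 := key _ _ h'
    have h2 : ((4 * v : ℤ) : ZMod 8) = ((4 : ℤ) : ZMod 8) := by exact_mod_cast h1.1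
    have h3 : ((4 * w : ℤ) : ZMod 8) = ((4 : ℤ) : ZMod 8) := by exact_mod_cast h1.2
    rw [ZMod.intCast_eq_intCast_iff_dvd_sub] at h2 h3
    push_cast at h2 h3
    omega
  let ε : Bool → ℤ := fun b => if b then 1 else -1
  have hε : ∀ b, ε b ^ 2 = 1 := by intro b; cases b <;> simp [ε]
  let F : {p : ℤ × ℤ // p.1.natAbs ^ 2 + 2 * p.2.natAbs ^ 2 = 24 * n + 19} × Bool →
      {p : ℤ × ℤ // p.1.natAbs ^ 2 + triInt p.2 = 9 * n + 7} := fun q =>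
    ⟨(ε q.2 * ((q.1.1.1 + q.1.1.2) / 2), (q.1.1.1 - 2 * q.1.1.2 - 1) / 2), by
      obtain ⟨⟨⟨v, w⟩, h⟩, b⟩ := q
      rw [natAbs_form_iff] at h
      have h2 := hodd v w h
      obtain ⟨k, hk⟩ : ∃ k, v + w = 2 * k := ⟨(v + w) / 2, by omega⟩
      obtain ⟨l, hl⟩ : ∃ l, v - 2 * w - 1 = 2 * l := ⟨(v - 2 * w - 1) / 2, by omega⟩
      dsimp only
      rw [hiff, hk, hl, Int.mul_ediv_cancel_left _ two_ne_zero,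
        Int.mul_ediv_cancel_left _ two_ne_zero, mul_pow, hε]
      push_cast at h
      linear_combination 3 * h - 2 * (v + w + 2 * k) * hk - (v - 2 * w + 2 * l + 1) * hl⟩
  have hF : Function.Bijective F := by
    constructor
    · rintro ⟨⟨⟨v, w⟩, h⟩, b⟩ ⟨⟨⟨v', w'⟩, h'⟩, b'⟩ heq
      rw [natAbs_form_iff] at h h'
      have h2 := hodd v w h
      have h2' := hodd v' w' h'
      have h3 := congrArg (fun q => q.1.1) heq
      have h4 := congrArg (fun q => q.1.2) heq
      dsimp only [F] at h3 h4
      -- This separates the two signs: v - 2w ≡ v + w mod 3, so equal images with opposite signs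
      -- would force v + w ≡ 0.
      have hmod : ∀ v w : ℤ, v ^ 2 + 2 * w ^ 2 = (24 * n + 19 : ℕ) → (v + w) % 3 ≠ 0 := by
        intro v w h h0
        obtain ⟨k, hk⟩ : ∃ k, v = 3 * k - w := ⟨(v + w) / 3, by omega⟩
        subst hk
        push_cast at h
        ring_nf at h
        omega
      have ha := hmod v w h
      have hb := hmod v' w' h'
      have : v = v' ∧ w = w' ∧ b = b' := by
        cases b <;> cases b' <;> simp [ε] at h3 ⊢ <;> omega
      obtain ⟨rfl, rfl, rfl⟩ := this
      rfl
    · rintro ⟨⟨x, c⟩, h⟩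
      have h0 := (hiff x c).1 h
      have hmod : (2 * c + 1 - 2 * x) % 3 = 0 ∨ (2 * c + 1 + 2 * x) % 3 = 0 := by
        have : (3 : ℤ) ∣ (2 * c + 1 - 2 * x) * (2 * c + 1 + 2 * x) :=
          ⟨24 * n + 19 - 4 * x ^ 2, by linear_combination h0⟩
        rcases Int.prime_three.dvd_or_dvd this with h | h <;> omega
      rcases hmod with hm | hm
      -- Solving v + w = 2x, v - 2w = 2c + 1 gives w = k and v = 2x - k.
      · obtain ⟨k, hk⟩ : ∃ k, 2 * c + 1 = 2 * x - 3 * k := ⟨(2 * x - 2 * c - 1) / 3, by omega⟩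
        refine ⟨⟨⟨(2 * x - k, k), ?_⟩, true⟩, ?_⟩
        · rw [natAbs_form_iff]
          rw [hk] at h0
          push_cast
          linarith
        · refine Subtype.ext (Prod.ext ?_ ?_) <;> simp [F, ε] <;> omega
      · obtain ⟨k, hk⟩ : ∃ k, 2 * c + 1 = - 2 * x - 3 * k := ⟨(-2 * x - 2 * c - 1) / 3, by omega⟩
        refine ⟨⟨⟨(-2 * x - k, k), ?_⟩, false⟩, ?_⟩
        · rw [natAbs_form_iff]
          rw [hk] at h0
          push_cast
          linarith
        · refine Subtype.ext (Prod.ext ?_ ?_) <;> simp [F, ε] <;> omega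
  rw [← Nat.card_eq_of_bijective F hF, Nat.card_prod, repCount]
  simp [mul_comm]

lemma triNat_ne (s n : ℕ) : s * (s + 1) / 2 ≠ 9 * n + 7 := by
  intro h
  have h1 := eight_mul_triNat s
  rw [h] at h1
  have : ∀ a : ZMod 9, a ^ 2 ≠ 3 := by decide
  refine this ((2 * s + 1 : ℕ) : ZMod 9) ?_
  rw [← Nat.cast_pow, ← h1, show 8 * (9 * n + 7) + 1 = 9 * (8 * n + 6) + 3 by ring]
  simp [show (9 : ZMod 9) = 0 from rfl]

/-- A sum of two squares divisible by 3 is divisible by 9, whereas 8(9n+7)+1 ≡ 3 mod 9. -/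
lemma two_mul_sq_add_triNat_ne (s k n : ℕ) : 2 * (s + 1) ^ 2 + k * (k + 1) / 2 ≠ 9 * n + 7 := by
  intro h
  have h1 := eight_mul_triNat k
  have : ∀ a b : ZMod 9, 16 * a ^ 2 + b ^ 2 ≠ 3 := by decide
  refine this ((s + 1 : ℕ) : ZMod 9) ((2 * k + 1 : ℕ) : ZMod 9) ?_
  have h2 : 16 * (s + 1) ^ 2 + (2 * k + 1) ^ 2 = 9 * (8 * n + 6) + 3 := by linarith
  have h3 := congrArg (Nat.cast : ℕ → ZMod 9) h2
  push_cast at h3 ⊢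
  rw [h3]
  simp [show (9 : ZMod 9) = 0 from rfl]

lemma pow_eq_expand (p : ℕ) [hp : Fact p.Prime] (f : (ZMod p)⟦X⟧) :
    f ^ p = expand p hp.out.ne_zero f := by
  have h := MvPowerSeries.map_frobenius_expand p hp.out.ne_zero (f := f)
  rw [ZMod.frobenius_zmod, MvPowerSeries.map_id] at h
  exact h.symm

/-- By Frobenius, S² ≡ S(q²) mod 2, so only the excluded exponents 2(s+1)² + k(k+1)/2 occur. -/
theorem two_dvd_coeff_sq_mul (n : ℕ) :
    2 ∣ coeff (9 * n + 7) ((repSeries ℤ fun s : ℕ => (s + 1) ^ 2) ^ 2 *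
      repSeries ℤ fun s : ℕ => s * (s + 1) / 2) := by
  refine (ZMod.intCast_zmod_eq_zero_iff_dvd _ 2).1 ?_
  rw [← eq_intCast (Int.castRingHom (ZMod 2)), ← coeff_map, map_mul, map_pow, map_repSeries, map_repSeries,
    pow_eq_expand, expand_repSeries,
    repSeries_mul (finiteFibers_succ_sq.mul_left two_ne_zero) finiteFibers_triNat]
  exact coeff_repSeries_eq_zero fun p => two_mul_sq_add_triNat_ne _ _ _

theorem two_mul_coeff_mul (n : ℕ) :
    2 * coeff (9 * n + 7) ((repSeries ℤ fun s : ℕ => (s + 1) ^ 2) *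
      repSeries ℤ fun s : ℕ => s * (s + 1) / 2) = repCount (24 * n + 19) := by
  have h : theta ℤ * thetaTri ℤ = repSeries ℤ fun p : ℤ × ℤ => p.1.natAbs ^ 2 + triInt p.2 :=
    repSeries_mul finiteFibers_sq finiteFibers_triInt
  have hc := congrArg (coeff (9 * n + 7)) h
  rw [coeff_repSeries, card_triangular_form, theta_eq, thetaTri_eq,
    show ∀ a b : ℤ⟦X⟧, (1 + 2 * a) * (2 * b) = 2 * b + 2 * (2 * (a * b)) by intros; ring,
    map_add, coeff_two_mul, coeff_two_mul, coeff_two_mul,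
    coeff_repSeries_eq_zero fun s => triNat_ne s n] at hc
  push_cast at hc
  linarith

/-- Modulo `8`, the values of `ped` along `9 n + 7` are representation numbers. -/
theorem ped_modEq_eight (n : ℕ) : ped (9 * n + 7) ≡ repCount (24 * n + 19) [MOD 8] := by
  have h := rescale_ped_mul
  set P := rescale (-1 : ℤ) (PowerSeries.mk fun n => (ped n : ℤ)) with hP
  set S := repSeries ℤ fun s : ℕ => (s + 1) ^ 2 with hS
  set T := repSeries ℤ fun s : ℕ => s * (s + 1) / 2 with hT
  -- This is the geometric expansion of 1/(1+2S), from (1+2S)(1-2S+4S²) = 1+8S³.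
  have h1 : P = T + 2 * (2 * (S ^ 2 * T)) - 2 * (S * T) - 2 * (2 * (2 * (S ^ 3 * P))) := by
    linear_combination (1 - 2 * S + 4 * S ^ 2) * h
  have h2 := congrArg (coeff (9 * n + 7)) h1
  simp only [map_add, map_sub, coeff_two_mul] at h2
  rw [two_mul_coeff_mul, coeff_repSeries_eq_zero fun s => triNat_ne s n, hP, coeff_rescale,
    coeff_mk] at h2
  obtain ⟨a, ha⟩ := two_dvd_coeff_sq_mul n
  obtain ⟨b, hb⟩ := four_dvd_repCount n
  rw [ha, hb] at h2
  rw [hb]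
  -- The sign is immaterial: a multiple of 4 equals its negative mod 8.
  rcases neg_one_pow_eq_or ℤ (9 * n + 7) with hs | hs <;> rw [hs] at h2 <;>
    push_cast at h2 <;> unfold Nat.ModEq <;> omega

/-! ### The form at the prime 5, where -2 is a non-residue -/

lemma five_dvd_of_form {v w : ℤ} (h : (5 : ℤ) ∣ v ^ 2 + 2 * w ^ 2) : 5 ∣ v ∧ 5 ∣ w := by
  have key : ∀ a b : ZMod 5, a ^ 2 + 2 * b ^ 2 = 0 → a = 0 ∧ b = 0 := by decide
  have h' := (ZMod.intCast_zmod_eq_zero_iff_dvd _ 5).2 h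
  push_cast at h'
  exact ⟨(ZMod.intCast_zmod_eq_zero_iff_dvd _ 5).1 (key _ _ h').1,
    (ZMod.intCast_zmod_eq_zero_iff_dvd _ 5).1 (key _ _ h').2⟩

theorem repCount_eq_zero {m : ℕ} (h5 : 5 ∣ m) (h25 : ¬ 25 ∣ m) : repCount m = 0 := by
  have : IsEmpty {p : ℤ × ℤ // p.1.natAbs ^ 2 + 2 * p.2.natAbs ^ 2 = m} := by
    refine ⟨fun ⟨⟨v, w⟩, h⟩ => h25 ?_⟩
    rw [natAbs_form_iff] at h
    obtain ⟨⟨a, rfl⟩, b, rfl⟩ := five_dvd_of_form (v := v) (w := w) (by rw [h]; exact_mod_cast h5)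
    zify
    exact ⟨a ^ 2 + 2 * b ^ 2, by rw [← h]; ring⟩
  exact Nat.card_of_isEmpty

theorem repCount_mul_twentyfive (m : ℕ) : repCount (25 * m) = repCount m := by
  refine (Nat.card_eq_of_bijective (fun p : {p : ℤ × ℤ // p.1.natAbs ^ 2 + 2 * p.2.natAbs ^ 2 = m} =>
    (⟨(5 * p.1.1, 5 * p.1.2), by
      have := p.2
      rw [natAbs_form_iff] at this ⊢
      push_cast
      rw [← this]; ring⟩ : {p : ℤ × ℤ // p.1.natAbs ^ 2 + 2 * p.2.natAbs ^ 2 = 25 * m}))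
    ⟨?_, ?_⟩).symm
  · rintro ⟨⟨v, w⟩, h⟩ ⟨⟨v', w'⟩, h'⟩ heq
    simpa using heq
  · rintro ⟨⟨v, w⟩, h⟩
    have h' := h
    rw [natAbs_form_iff] at h'
    obtain ⟨⟨a, rfl⟩, b, rfl⟩ := five_dvd_of_form (v := v) (w := w)
      ⟨5 * m, by rw [h']; push_cast; ring⟩
    refine ⟨⟨(a, b), ?_⟩, rfl⟩
    rw [natAbs_form_iff]
    push_cast at h'
    linarith

theorem repCount_mul_pow (k m : ℕ) : repCount (25 ^ k * m) = repCount m := by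
  induction k with
  | zero => simp
  | succ k ih => rw [pow_succ', mul_assoc, repCount_mul_twentyfive, ih]

/-! ### Dissections of theta series -/

section Dissections

variable {R : Type*} [CommRing R]

/-- Sorting the representations by the residue class of the represented index. -/
lemma repSeries_eq_sum_residues {f : ℤ → ℕ} (hf : FiniteFibers f) (k : ℕ) [NeZero k] :
    repSeries R f = ∑ r : Fin k, repSeries R fun q : ℤ => f (k * q + (r : ℕ)) := by
  ext n
  have e : {p : ℤ × Fin k // f (k * p.1 + (p.2 : ℕ)) = n} ≃
      Σ r : Fin k, {q : ℤ // f (k * q + (r : ℕ)) = n} :=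
    { toFun := fun p => ⟨p.1.2, p.1.1, p.2⟩
      invFun := fun y => ⟨(y.2.1, y.1), y.2.2⟩
      left_inv := fun _ => rfl
      right_inv := fun _ => rfl }
  have : ∀ r : Fin k, Finite {q : ℤ // f (k * q + (r : ℕ)) = n} := fun r =>
    have := hf n
    Finite.of_injective (β := {x : ℤ // f x = n}) (fun q => ⟨k * q.1 + (r : ℕ), q.2⟩)
      fun a b h => Subtype.ext (by
        have := Subtype.mk.inj h
        have hk : (k : ℤ) ≠ 0 := by exact_mod_cast NeZero.ne k
        exact mul_left_cancel₀ hk (add_right_cancel this))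
  rw [coeff_repSeries, Nat.card_congr (((Int.divModEquiv k).symm.subtypeEquiv fun p => by
    rw [Int.divModEquiv_symm_apply, mul_comm]).symm.trans e), Nat.card_sigma, map_sum]
  simp

lemma X_mul_repSeries {ι : Type*} (f : ι → ℕ) :
    X * repSeries R f = repSeries R fun i => f i + 1 := by
  ext n
  cases n with
  | zero => rw [coeff_zero_X_mul, coeff_repSeries_eq_zero fun i => Nat.succ_ne_zero _]
  | succ n => rw [coeff_succ_X_mul, coeff_repSeries, coeff_repSeries]; simp

lemma triInt_eq {u : ℤ} {m : ℕ} (h : (2 * u + 1) ^ 2 = 8 * m + 1) : triInt u = m := by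
  have := eight_mul_triInt u
  omega

lemma theta_two_dissection :
    theta R = expand 4 four_ne_zero (theta R) + X * expand 8 (by norm_num) (thetaTri R) := by
  conv_lhs => rw [theta, repSeries_eq_sum_residues finiteFibers_sq 2, Fin.sum_univ_two]
  rw [theta, thetaTri, expand_repSeries, expand_repSeries, X_mul_repSeries]
  congr 2 <;> funext q <;> zify <;> simp only [sq_abs]
  · simp; ring
  · have := eight_mul_triInt q
    simp only [Fin.val_one]
    push_cast
    linarith

lemma theta_three_dissection :
    ∃ β : R⟦X⟧, theta R = expand 3 three_ne_zero (expand 3 three_ne_zero (theta R)) + β ∧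
      ∀ n, n % 3 ≠ 1 → coeff n β = 0 := by
  refine ⟨(repSeries R fun q : ℤ => ((3 : ℕ) * q + ((1 : Fin 3) : ℕ)).natAbs ^ 2) +
    repSeries R fun q : ℤ => ((3 : ℕ) * q + ((2 : Fin 3) : ℕ)).natAbs ^ 2, ?_, ?_⟩
  · conv_lhs => rw [theta, repSeries_eq_sum_residues finiteFibers_sq 3, Fin.sum_univ_three]
    rw [theta, expand_repSeries, expand_repSeries, add_assoc]
    congr 2
    funext q
    zify
    simp only [sq_abs]
    simp; ring
  · intro n hn
    rw [map_add, coeff_repSeries_eq_zero, coeff_repSeries_eq_zero, add_zero]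
    · intro q h
      zify at h
      simp only [sq_abs, Fin.val_two] at h
      push_cast at h
      ring_nf at h
      omega
    · intro q h
      zify at h
      simp only [sq_abs, Fin.val_one] at h
      push_cast at h
      ring_nf at h
      omega

/-- For u = 3q+1, 8t+1 = (6q+3)² yields t = 9·q(q+1)/2 + 1; for the other residues of u the
triangular number is divisible by 3. -/
lemma thetaTri_three_dissection :
    ∃ α : R⟦X⟧, thetaTri R = α + X * expand 3 three_ne_zero (expand 3 three_ne_zero (thetaTri R)) ∧
      ∀ n, n % 3 ≠ 0 → coeff n α = 0 := by
  refine ⟨(repSeries R fun q : ℤ => triInt ((3 : ℕ) * q + ((0 : Fin 3) : ℕ))) +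
    repSeries R fun q : ℤ => triInt ((3 : ℕ) * q + ((2 : Fin 3) : ℕ)), ?_, ?_⟩
  · conv_lhs => rw [thetaTri, repSeries_eq_sum_residues finiteFibers_triInt 3, Fin.sum_univ_three,
      add_right_comm]
    rw [thetaTri, expand_repSeries, expand_repSeries, X_mul_repSeries]
    congr 2
    funext q
    refine triInt_eq ?_
    have := eight_mul_triInt q
    simp only [Fin.val_one]
    push_cast
    linarith
  · intro n hn
    rw [map_add, coeff_repSeries_eq_zero, coeff_repSeries_eq_zero, add_zero]
    · intro q h
      have h1 := eight_mul_triInt (3 * q + 2)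
      simp only [Fin.val_two] at h
      push_cast at h
      rw [h] at h1
      ring_nf at h1
      omega
    · intro q h
      have h1 := eight_mul_triInt (3 * q)
      simp only [Fin.val_zero] at h
      push_cast at h
      rw [add_zero] at h
      rw [h] at h1
      ring_nf at h1
      omega

/-- Pairs of integers, sorted by the parity of their difference. -/
def pairParityEquiv : (ℤ × ℤ) ⊕ (ℤ × ℤ) ≃ ℤ × ℤ where
  toFun := Sum.elim (fun p => (p.1 + p.2, p.1 - p.2 - 1)) fun p => (p.2 + p.1, p.2 - p.1)
  invFun p := if (p.1 - p.2) % 2 = 1 then Sum.inl ((p.1 + p.2 + 1) / 2, (p.1 - p.2 - 1) / 2)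
    else Sum.inr ((p.1 - p.2) / 2, (p.1 + p.2) / 2)
  left_inv := by
    rintro (⟨x, c⟩ | ⟨x, c⟩)
    · dsimp only [Sum.elim_inl]
      rw [if_pos (by omega)]
      congr 2 <;> omega
    · dsimp only [Sum.elim_inr]
      rw [if_neg (by omega)]
      congr 2 <;> omega
  right_inv := by
    rintro ⟨a, b⟩
    dsimp only
    split_ifs with h
    · simp only [Sum.elim_inl]
      ext <;> dsimp only <;> omega
    · simp only [Sum.elim_inr]
      ext <;> dsimp only <;> omega

/-- Rotate the lattice: (2a+1)² + (2b+1)² = 8x² + 2(2c+1)², where {a, b} is x+c, x-c-1 or c+x, c-x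
according to the parity of a - b. -/
theorem thetaTri_sq : thetaTri R ^ 2 = 2 * (theta R * expand 2 two_ne_zero (thetaTri R)) := by
  have hfin := finiteFibers_sq.add (finiteFibers_triInt.mul_left two_ne_zero)
  rw [sq, thetaTri, theta, expand_repSeries,
    repSeries_mul finiteFibers_sq (finiteFibers_triInt.mul_left two_ne_zero),
    repSeries_mul finiteFibers_triInt finiteFibers_triInt, two_mul, ← repSeries_sum hfin hfin]
  refine (repSeries_equiv pairParityEquiv ?_).symm
  rintro (⟨x, c⟩ | ⟨x, c⟩)
  · have h1 := eight_mul_triInt (x + c)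
    have h2 := eight_mul_triInt (x - c - 1)
    have h3 := eight_mul_triInt c
    simp only [pairParityEquiv, Equiv.coe_fn_mk, Sum.elim_inl]
    zify
    rw [sq_abs]
    linarith
  · have h1 := eight_mul_triInt (c + x)
    have h2 := eight_mul_triInt (c - x)
    have h3 := eight_mul_triInt c
    simp only [pairParityEquiv, Equiv.coe_fn_mk, Sum.elim_inr]
    zify
    rw [sq_abs]
    linarith

end Dissections

/-! ### Four squares and a Hurwitz unit of order three -/

/-- Left multiplication by the Hurwitz unit `(-1 + i + j + k) / 2` on quaternions. -/
def hurwitzRotation (p : (ℤ × ℤ) × (ℤ × ℤ)) : (ℤ × ℤ) × (ℤ × ℤ) :=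
  (((-p.1.1 - p.1.2 - p.2.1 - p.2.2) / 2, (p.1.1 - p.1.2 - p.2.1 + p.2.2) / 2),
    ((p.1.1 + p.1.2 - p.2.1 - p.2.2) / 2, (p.1.1 - p.1.2 + p.2.1 - p.2.2) / 2))

/-- A fixed-point-free map of order three acts on a set whose cardinality is divisible by three. -/
lemma three_dvd_card_of_orbits {A : Type*} [Finite A] (f : A → A) (h3 : ∀ x, f (f (f x)) = x)
    (hne : ∀ x, f x ≠ x) : 3 ∣ Nat.card A := by
  classical
  have := Fintype.ofFinite A
  let g : Function.End A := f
  have hg : g ^ 3 ^ 1 = 1 := by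
    rw [pow_one, pow_three]
    exact funext h3
  have key := Equiv.Perm.card_fixedPoints_modEq hg
  have h0 : IsEmpty (Function.fixedPoints g) := ⟨fun x => hne x.1 x.2⟩
  rw [Nat.card_eq_fintype_card]
  refine Nat.modEq_zero_iff_dvd.1 (key.trans ?_)
  rw [Fintype.card_eq_zero_iff.2 h0]

theorem three_dvd_card_sum_four_squares {m : ℕ} (hm : m ≠ 0) :
    3 ∣ Nat.card {p : (ℤ × ℤ) × (ℤ × ℤ) // p.1.1.natAbs ^ 2 + p.1.2.natAbs ^ 2 +
      (p.2.1.natAbs ^ 2 + p.2.2.natAbs ^ 2) = 4 * m} := by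
  set A := {p : (ℤ × ℤ) × (ℤ × ℤ) // p.1.1.natAbs ^ 2 + p.1.2.natAbs ^ 2 +
      (p.2.1.natAbs ^ 2 + p.2.2.natAbs ^ 2) = 4 * m} with hA
  have hfin : Finite A := (finiteFibers_sq.add finiteFibers_sq).add
    (finiteFibers_sq.add finiteFibers_sq) (4 * m)
  have hiff : ∀ a b c d : ℤ, a.natAbs ^ 2 + b.natAbs ^ 2 + (c.natAbs ^ 2 + d.natAbs ^ 2) = 4 * m ↔
      a ^ 2 + b ^ 2 + (c ^ 2 + d ^ 2) = 4 * m := by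
    intro a b c d
    zify; simp
  have hpar : ∀ a b c d : ℤ, a ^ 2 + b ^ 2 + (c ^ 2 + d ^ 2) = 4 * m →
      (a + b + c + d) % 2 = 0 := by
    intro a b c d h
    have : Even (a ^ 2 + b ^ 2 + (c ^ 2 + d ^ 2)) := by rw [h]; exact ⟨2 * m, by ring⟩
    simp only [Int.even_add, Int.even_pow' two_ne_zero] at this
    rw [← Int.even_iff]
    simp only [Int.even_add]
    tauto
  let f : A → A := fun p => ⟨hurwitzRotation p.1, by
    obtain ⟨⟨⟨a, b⟩, c, d⟩, h⟩ := p
    have h := (hiff a b c d).1 h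
    have h2 := hpar a b c d h
    -- The coordinate sum is even, so this parametrisation makes all the halvings exact.
    obtain ⟨k, rfl⟩ : ∃ k, a = 2 * k - b - c - d := ⟨(a + b + c + d) / 2, by omega⟩
    refine (hiff _ _ _ _).2 ?_
    dsimp only [hurwitzRotation]
    rw [show (-(2 * k - b - c - d) - b - c - d) / 2 = -k by omega,
      show (2 * k - b - c - d - b - c + d) / 2 = k - b - c by omega,
      show (2 * k - b - c - d + b - c - d) / 2 = k - c - d by omega,
      show (2 * k - b - c - d - b + c - d) / 2 = k - b - d by omega]
    linarith⟩
  refine three_dvd_card_of_orbits f (fun p => ?_) fun p hp => ?_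
  · obtain ⟨⟨⟨a, b⟩, c, d⟩, h⟩ := p
    have h2 := hpar a b c d ((hiff a b c d).1 h)
    obtain ⟨k, rfl⟩ : ∃ k, a = 2 * k - b - c - d := ⟨(a + b + c + d) / 2, by omega⟩
    refine Subtype.ext ?_
    change hurwitzRotation (hurwitzRotation (hurwitzRotation _)) = _
    have e1 : hurwitzRotation ((2 * k - b - c - d, b), (c, d)) =
        ((-k, k - b - c), (k - c - d, k - b - d)) := by
      ext <;> dsimp only [hurwitzRotation] <;> omega
    have e2 : hurwitzRotation ((-k, k - b - c), (k - c - d, k - b - d)) =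
        ((b + c + d - k, c - k), (d - k, b - k)) := by
      ext <;> dsimp only [hurwitzRotation] <;> omega
    have e3 : hurwitzRotation ((b + c + d - k, c - k), (d - k, b - k)) =
        ((2 * k - b - c - d, b), (c, d)) := by
      ext <;> dsimp only [hurwitzRotation] <;> omega
    rw [e1, e2, e3]
  · obtain ⟨⟨⟨a, b⟩, c, d⟩, h⟩ := p
    have h1 := (hiff a b c d).1 h
    have h2 := hpar a b c d h1
    have h3 := congrArg Subtype.val hp
    simp only [f, hurwitzRotation, Prod.mk.injEq] at h3
    obtain ⟨rfl, rfl, rfl, rfl⟩ : a = 0 ∧ b = 0 ∧ c = 0 ∧ d = 0 := by omega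
    exact hm (by simpa using h1.symm)

/-! ### `ped` modulo 3 -/

section ModThree

lemma three_eq_zero_series : (3 : (ZMod 3)⟦X⟧) = 0 := by
  have : (3 : ZMod 3) = 0 := rfl
  rw [← map_ofNat (C (R := ZMod 3)), this, map_zero]

lemma coeff_X_pow_mul_expand {R : Type*} [CommRing R] {k : ℕ} (hk : k ≠ 0) (f : R⟦X⟧) {j n : ℕ}
    (h : n % k ≠ j % k) : coeff n (X ^ j * expand k hk f) = 0 := by
  rw [coeff_X_pow_mul']
  split_ifs with hj
  · refine coeff_expand_of_not_dvd _ _ _ fun hd => h ?_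
    exact ((Nat.modEq_iff_dvd' hj).2 hd).symm
  · rfl

/-- The part of the fourth power of the theta series supported on multiples of four. -/
lemma coeff_theta_pow_four {R : Type*} [CommRing R] (m : ℕ) :
    coeff (4 * m) (theta R ^ 4) =
      coeff m (theta R ^ 4 + X * expand 2 two_ne_zero (thetaTri R) ^ 4) := by
  set A := theta R with hA
  set B := expand 2 two_ne_zero (thetaTri R) with hB
  have h : A = expand 4 four_ne_zero A + X * expand 4 four_ne_zero B := by
    conv_lhs => rw [hA, theta_two_dissection]
    rw [hB, ← expand_mul]
  have h4 : A ^ 4 = expand 4 four_ne_zero (A ^ 4 + X * B ^ 4) +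
      X ^ 1 * expand 4 four_ne_zero (4 * A ^ 3 * B) +
      X ^ 2 * expand 4 four_ne_zero (6 * A ^ 2 * B ^ 2) +
      X ^ 3 * expand 4 four_ne_zero (4 * A * B ^ 3) := by
    conv_lhs => rw [h]
    simp only [map_add, map_mul, map_pow, expand_X, map_ofNat]
    ring
  rw [congrArg (coeff (4 * m)) h4, map_add, map_add, map_add, coeff_expand_mul,
    coeff_X_pow_mul_expand, coeff_X_pow_mul_expand, coeff_X_pow_mul_expand]
  · rw [add_zero, add_zero, add_zero]
  all_goals omega

lemma theta_pow_four_eq {R : Type*} [CommRing R] :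
    theta R ^ 4 = repSeries R fun p : (ℤ × ℤ) × (ℤ × ℤ) =>
      p.1.1.natAbs ^ 2 + p.1.2.natAbs ^ 2 + (p.2.1.natAbs ^ 2 + p.2.2.natAbs ^ 2) := by
  rw [show theta R ^ 4 = theta R * theta R * (theta R * theta R) by ring, theta,
    repSeries_mul finiteFibers_sq finiteFibers_sq, repSeries_mul
      (finiteFibers_sq.add finiteFibers_sq) (finiteFibers_sq.add finiteFibers_sq)]

lemma constantCoeff_theta {R : Type*} [CommRing R] : constantCoeff (theta R) = 1 := by
  rw [theta_eq, map_add, map_mul, map_one, ← coeff_zero_eq_constantCoeff_apply (repSeries R _),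
    coeff_repSeries_eq_zero fun s => by positivity, mul_zero, add_zero]

/-- The coefficient at m > 0 counts representations of 4m as four squares, a multiple of 3. -/
theorem theta_pow_four_add :
    theta (ZMod 3) ^ 4 + X * expand 2 two_ne_zero (thetaTri (ZMod 3)) ^ 4 = 1 := by
  ext m
  rcases eq_or_ne m 0 with rfl | hm
  · simp [constantCoeff_theta]
  · rw [← coeff_theta_pow_four, coeff_one, if_neg hm, theta_pow_four_eq, coeff_repSeries,
      ZMod.natCast_eq_zero_iff]
    exact three_dvd_card_sum_four_squares hm

/-- With B = G(q²): G⁸ = (2FB)⁴ ≡ F⁴B⁴ and qB⁴ = 1 - F⁴. -/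
lemma X_mul_thetaTri_pow_eight :
    X * thetaTri (ZMod 3) ^ 8 = theta (ZMod 3) ^ 4 - theta (ZMod 3) ^ 8 := by
  have h1 := theta_pow_four_add
  have h2 := thetaTri_sq (R := ZMod 3)
  have h3 := three_eq_zero_series
  set F := theta (ZMod 3)
  set G := thetaTri (ZMod 3)
  set B := expand 2 two_ne_zero G
  rw [show G ^ 8 = (G ^ 2) ^ 4 by ring, h2]
  linear_combination F ^ 4 * h1 + 5 * X * F ^ 4 * B ^ 4 * h3

/-- The exponents occurring in `f` are all congruent to `r` modulo three. -/
def SupportedMod (r : ℕ) (f : (ZMod 3)⟦X⟧) : Prop := ∀ n, n % 3 ≠ r % 3 → coeff n f = 0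

lemma SupportedMod.mul {r s : ℕ} {f g : (ZMod 3)⟦X⟧} (hf : SupportedMod r f)
    (hg : SupportedMod s g) : SupportedMod (r + s) (f * g) := by
  intro n hn
  rw [coeff_mul]
  refine sum_eq_zero fun p hp => ?_
  rw [HasAntidiagonal.mem_antidiagonal] at hp
  by_cases h1 : p.1 % 3 = r % 3
  · rw [hg p.2 (by omega), mul_zero]
  · rw [hf p.1 h1, zero_mul]

lemma SupportedMod.add {r : ℕ} {f g : (ZMod 3)⟦X⟧} (hf : SupportedMod r f)
    (hg : SupportedMod r g) : SupportedMod r (f + g) := fun n hn => by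
  rw [map_add, hf n hn, hg n hn, add_zero]

lemma SupportedMod.neg {r : ℕ} {f : (ZMod 3)⟦X⟧} (hf : SupportedMod r f) :
    SupportedMod r (-f) := fun n hn => by
  rw [map_neg, hf n hn, neg_zero]

lemma SupportedMod.congr {r s : ℕ} {f : (ZMod 3)⟦X⟧} (hf : SupportedMod r f)
    (h : r % 3 = s % 3) : SupportedMod s f := fun n hn => hf n (h ▸ hn)

lemma supportedMod_cube (f : (ZMod 3)⟦X⟧) : SupportedMod 0 (f ^ 3) := by
  intro n hn
  have : Fact (Nat.Prime 3) := ⟨Nat.prime_three⟩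
  rw [pow_eq_expand]
  exact coeff_expand_of_not_dvd _ _ _ (by omega)

lemma supportedMod_X : SupportedMod 1 X := by
  intro n hn
  rw [coeff_X, if_neg]
  rintro rfl
  exact hn rfl

lemma pow_nine_eq_expand (f : (ZMod 3)⟦X⟧) :
    expand 3 three_ne_zero (expand 3 three_ne_zero f) = f ^ 9 := by
  have : Fact (Nat.Prime 3) := ⟨Nat.prime_three⟩
  rw [show f ^ 9 = (f ^ 3) ^ 3 by ring, pow_eq_expand, pow_eq_expand]

/-- Modulo three, `ped` along `3 n + 1` is generated by a product of theta series; the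
remaining terms are collected by residue class. -/
lemma quotient_three_dissection {P : (ZMod 3)⟦X⟧} (hP : P * theta (ZMod 3) = -thetaTri (ZMod 3)) :
    ∃ A B : (ZMod 3)⟦X⟧, SupportedMod 0 A ∧ SupportedMod 2 B ∧
      P = A + X * (thetaTri (ZMod 3) ^ 3 * theta (ZMod 3)) ^ 3 + B := by
  have hY := X_mul_thetaTri_pow_eight
  have h3 := three_eq_zero_series
  obtain ⟨β, hF, hβ⟩ := theta_three_dissection (R := ZMod 3)
  obtain ⟨α, hG, hα⟩ := thetaTri_three_dissection (R := ZMod 3)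
  rw [pow_nine_eq_expand] at hF hG
  have : Fact (Nat.Prime 3) := ⟨Nat.prime_three⟩
  have hi : theta (ZMod 3) * (theta (ZMod 3))⁻¹ = 1 :=
    PowerSeries.mul_inv_cancel _ (by rw [constantCoeff_theta]; exact one_ne_zero)
  set F := theta (ZMod 3)
  set G := thetaTri (ZMod 3)
  set i := F⁻¹
  have hα' : SupportedMod 0 α := hα
  have hβ' : SupportedMod 1 β := hβ
  have hi3 : F ^ 3 * i ^ 3 = 1 := by rw [← mul_pow, hi, one_pow]
  have hαe : α = G - X * G ^ 9 := by linear_combination -hG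
  have hβe : β = F - F ^ 9 := by linear_combination -hF
  -- Write -G/F = -GF²/F³, where F³ is a series in q³. The witnesses are the residue 0 and 2 parts
  -- of (α + qG⁹)(F⁹ + β)², divided by -F³.
  refine ⟨-(i ^ 3 * (α * (F ^ 6) ^ 3 + X * (G ^ 3) ^ 3 * (β * β))),
    -(i ^ 3 * (α * (β * β) + X * (G ^ 3) ^ 3 * ((F ^ 3) ^ 3 * (β + β)))), ?_, ?_, ?_⟩
  · exact ((supportedMod_cube i).mul ((hα'.mul (supportedMod_cube _)).add
      (((supportedMod_X.mul (supportedMod_cube _)).mul (hβ'.mul hβ')).congr rfl))).neg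
  · exact ((supportedMod_cube i).mul (((hα'.mul (hβ'.mul hβ')).congr rfl).add
      (((supportedMod_X.mul (supportedMod_cube _)).mul
        ((supportedMod_cube _).mul (hβ'.add hβ')))))).neg
  -- The residue 1 part collapses to -qF⁶G⁹ through qG⁸ = F⁴ - F⁸.
  · have e1 : 2 * α * β * F ^ 9 + X * G ^ 9 * F ^ 18 + F ^ 6 * (X * G ^ 9) = 0 := by
      rw [hαe, hβe]
      linear_combination (-2 * G * (F - F ^ 9) * F ^ 9 + G * F ^ 18 + F ^ 6 * G) * hY +
        G * (F ^ 10 - F ^ 14 + F ^ 22 - F ^ 26) * h3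
    have e2 : G * F ^ 2 = α * (F ^ 6) ^ 3 + X * (G ^ 3) ^ 3 * (β * β) +
        (α * (β * β) + X * (G ^ 3) ^ 3 * ((F ^ 3) ^ 3 * (β + β))) +
        (2 * α * β * F ^ 9 + X * G ^ 9 * F ^ 18) := by
      rw [hαe, hβe]
      ring
    have e3 : P = -(G * F ^ 2 * i ^ 3) := by
      linear_combination F ^ 2 * i ^ 3 * hP - P * hi3
    linear_combination e3 - i ^ 3 * e2 - i ^ 3 * e1 + F ^ 3 * X * G ^ 9 * hi3

/-- A cube mod 3 is a series in q³, and squares are never 2 mod 3. -/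
lemma coeff_thetaTri_cube_mul_theta (n : ℕ) :
    coeff (3 * n + 2) (thetaTri (ZMod 3) ^ 3 * theta (ZMod 3)) = 0 := by
  obtain ⟨β, hF, hβ⟩ := theta_three_dissection (R := ZMod 3)
  rw [pow_nine_eq_expand, show ∀ f : (ZMod 3)⟦X⟧, f ^ 9 = (f ^ 3) ^ 3 by intro f; ring] at hF
  have hβ' : SupportedMod 1 β := hβ
  rw [hF, mul_add, map_add,
    ((supportedMod_cube _).mul (supportedMod_cube _)) _ (by omega),
    ((supportedMod_cube _).mul hβ') _ (by omega), add_zero]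

theorem three_dvd_ped (n : ℕ) : 3 ∣ ped (9 * n + 7) := by
  have h := congrArg (PowerSeries.map (Int.castRingHom (ZMod 3))) rescale_ped_mul
  have h3 := three_eq_zero_series
  rw [map_mul, ← theta_eq, theta, map_repSeries, map_repSeries, ← theta] at h
  set P := PowerSeries.map (Int.castRingHom (ZMod 3))
    (rescale (-1) (PowerSeries.mk fun n => (ped n : ℤ))) with hPdef
  have hP : P * theta (ZMod 3) = -thetaTri (ZMod 3) := by
    rw [thetaTri_eq, ← h]
    linear_combination P * theta (ZMod 3) * h3
  obtain ⟨A, B, hA, hB, hPeq⟩ := quotient_three_dissection hP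
  have hc : coeff (9 * n + 7) P = 0 := by
    have : Fact (Nat.Prime 3) := ⟨Nat.prime_three⟩
    rw [hPeq, map_add, map_add, hA _ (by omega), hB _ (by omega), coeff_succ_X_mul,
      pow_eq_expand, show 9 * n + 6 = 3 * (3 * n + 2) by ring, coeff_expand_mul,
      coeff_thetaTri_cube_mul_theta, add_zero, add_zero]
  rw [hPdef, coeff_map, coeff_rescale, coeff_mk, eq_intCast,
    ZMod.intCast_zmod_eq_zero_iff_dvd] at hc
  have h2 : ((3 : ℕ) : ℤ) ∣ (ped (9 * n + 7) : ℤ) := by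
    rcases neg_one_pow_eq_or ℤ (9 * n + 7) with hs | hs <;> rw [hs] at hc
    · simpa using hc
    · simpa using hc
  exact_mod_cast h2

end ModThree

/-! ### Combining the moduli 8 and 3 -/

lemma ped_modEq_zero {n : ℕ} (h : 5 ∣ 24 * n + 19) (h' : ¬ 25 ∣ 24 * n + 19) :
    ped (9 * n + 7) ≡ 0 [MOD 24] := by
  have h8 := ped_modEq_eight n
  rw [repCount_eq_zero h h'] at h8
  have h3 := three_dvd_ped n
  unfold Nat.ModEq at h8 ⊢
  omega

theorem theorem1p1 :
    (∀ n : ℕ,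
      ped (225 * n + 43) ≡ 0 [MOD 24] ∧
      ped (225 * n + 88) ≡ 0 [MOD 24] ∧
      ped (225 * n + 133) ≡ 0 [MOD 24] ∧
      ped (225 * n + 223) ≡ 0 [MOD 24]) ∧
    (∀ k n : ℕ, 1 ≤ k →
      ped (9 * n + 7) ≡ ped (9 * 5 ^ (2 * k) * n + (57 * 5 ^ (2 * k) - 1) / 8) [MOD 24]) := by
  refine ⟨fun n => ⟨?_, ?_, ?_, ?_⟩, fun k n _ => ?_⟩
  · rw [show 225 * n + 43 = 9 * (25 * n + 4) + 7 by ring]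
    exact ped_modEq_zero (by omega) (by omega)
  · rw [show 225 * n + 88 = 9 * (25 * n + 9) + 7 by ring]
    exact ped_modEq_zero (by omega) (by omega)
  · rw [show 225 * n + 133 = 9 * (25 * n + 14) + 7 by ring]
    exact ped_modEq_zero (by omega) (by omega)
  · rw [show 225 * n + 223 = 9 * (25 * n + 24) + 7 by ring]
    exact ped_modEq_zero (by omega) (by omega)
  · obtain ⟨c, hc⟩ : ∃ c, 25 ^ k = 24 * c + 1 := by
      have : 25 ^ k ≡ 1 [MOD 24] := by simpa using (show 25 ≡ 1 [MOD 24] from rfl).pow k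
      exact ⟨25 ^ k / 24, by unfold Nat.ModEq at this; omega⟩
    -- The new index N = (24c+1)n + 19c is chosen so that 24N + 19 = 25^k (24n + 19).
    have hN : 9 * 5 ^ (2 * k) * n + (57 * 5 ^ (2 * k) - 1) / 8 =
        9 * ((24 * c + 1) * n + 19 * c) + 7 := by
      rw [pow_mul, show 5 ^ 2 = 25 by norm_num, hc,
        show (57 * (24 * c + 1) - 1) / 8 = 171 * c + 7 by omega]
      ring
    have hrep : repCount (24 * ((24 * c + 1) * n + 19 * c) + 19) = repCount (24 * n + 19) := by
      rw [← repCount_mul_pow k (24 * n + 19), hc]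
      congr 1
      ring
    rw [hN]
    have h1 := ped_modEq_eight n
    have h2 := ped_modEq_eight ((24 * c + 1) * n + 19 * c)
    rw [hrep] at h2
    have h3 := three_dvd_ped n
    have h4 := three_dvd_ped ((24 * c + 1) * n + 19 * c)
    unfold Nat.ModEq at h1 h2 ⊢
    omega
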